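/- Let $X$ be a compact smooth manifold of dimension $m+1\ge 1$ with (possibly empty) boundary $\partial X$. For a Riemannian metric $g$ on $X$, let $\nabla^{TX}$ be its Levi-Civita connection, $\mathfrak n$ the inward pointing unit normal field along $\partial X$, $R^{T\partial X}$ the curvature of the Levi-Civita connection of the induced metric on $\partial X$, and $e_1,\dots,e_m$ a local orthonormal frame of $T\partial X$ with dual frame $e^1,\dots,e^m$. In the graded tensor product $\Lambda T^*\partial X\,\widehat\otimes\,\widehat{\Lambda T^*\partial X}$, where a hat marks elements of the second factor, put $$\dot R=\frac12\sum_{k,l}\langle e_k,R^{T\partial X}e_l\rangle\,\widehat{e^k}\wedge\widehat{e^l},\qquad \dot S=\frac12\sum_k\langle \nabla^{TX}\mathfrak n,e_k\rangle\,\widehat{e^k},$$ where $\langle e_k,R^{T\partial X}e_l\rangle$ is a 2-form and $\langle \nabla^{TX}\mathfrak n,e_k\rangle$ a 1-form on $\partial X$. For an orientation of $T_p\partial X$ and an oriented orthonormal basis $e_1,\dots,e_m$ of it, the Berezin integral is $$\int^{B}\alpha\,\widehat\otimes\,\widehat\beta=(-1)^{m(m+1)/2}\,\pi^{-m/2}\,\beta(e_1,\dots,e_m)\,\alpha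 ,$$ where $\beta(e_1,\dots,e_m)=0$ if $\beta$ is homogeneous of degree different from $m$; it changes sign with the orientation. The Brüning–Ma secondary class of $g$ is $$B(\nabla^{TX})=-\int_0^1\frac{du}{u}\int^{B}\exp\Bigl(-\frac12\dot R-u^2\dot S^2\Bigr)\sum_{k=1}^\infty\frac{(u\dot S)^k}{2\,\Gamma(k/2+1)}\in\Lambda T^*\partial X ,$$ a differential form on $\partial X$ if $\partial X$ is oriented, and in general one with values in the orientation bundle of $\partial X$. Let $g_1$ and $g_2=s\cdot g_1$, with a constant $s>0$, be Riemannian metrics on $X$, with Levi-Civita connections $\nabla^{TX}_1$ and $\nabla^{TX}_2$. Then $B(\nabla^{TX}_1)=B(\nabla^{TX}_2)$ at every point of $\partial X$ and for each orientation of its tangent space. -/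

import Mathlib

open scoped Manifold ContDiff TensorProduct
open Set Module Bundle

namespace BruningMa

noncomputable section

/-! ### Levi-Civita connection and curvature of a metric in coordinates -/

section Coordinates

variable {F : Type*} [NormedAddCommGroup F] [NormedSpace ℝ F]

/-- The Christoffel symbols of the first kind of the metric `G` on the domain `D`, as the covector
`w ↦ ½ (∂_u G(v,w) + ∂_v G(u,w) - ∂_w G(u,v))` at `x`. -/
def christoffelLower (G : F → F →L[ℝ] F →L[ℝ] ℝ) (D : Set F) (x u v : F) : F →L[ℝ] ℝ :=
  (1 / 2 : ℝ) • (fderivWithin ℝ G D x u v + fderivWithin ℝ G D x v u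
    - ((fderivWithin ℝ G D x).flip u).flip v)

/-- The Christoffel symbols `Γ(u,v)` of the metric `G` on the domain `D`: the vector with
`G(Γ(u,v), w) = ½ (∂_u G(v,w) + ∂_v G(u,w) - ∂_w G(u,v))` for all `w`. The Levi-Civita
connection of `G` is `∇_u W = D_u W + Γ(u, W)`. -/
def christoffel (G : F → F →L[ℝ] F →L[ℝ] ℝ) (D : Set F) (x u v : F) : F :=
  (G x).inverse (christoffelLower G D x u v)

/-- The Levi-Civita covariant derivative `∇_u W` at `y`, in a direction `u` tangent to a linear
subspace `P` with inclusion `L`, of a vector field `W` of the ambient space given along `P`. -/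
def covariantAlong {P : Type*} [NormedAddCommGroup P] [NormedSpace ℝ P]
    (G : F → F →L[ℝ] F →L[ℝ] ℝ) (D : Set F) (L : P →L[ℝ] F) (W : P → F) (y u : P) : F :=
  fderiv ℝ W y u + christoffel G D (L y) (L u) (W y)

/-- The Riemann curvature `R(u,v)w = ∇_u ∇_v w - ∇_v ∇_u w` at `x` of the metric `G` (for constant
vector fields `u`, `v`, `w`, whose brackets vanish). -/
def curvature (G : F → F →L[ℝ] F →L[ℝ] ℝ) (D : Set F) (x u v w : F) : F :=
  (fderivWithin ℝ (fun y ↦ christoffel G D y v w) D x u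
      + christoffel G D x u (christoffel G D x v w))
    - (fderivWithin ℝ (fun y ↦ christoffel G D y u w) D x v
      + christoffel G D x v (christoffel G D x u w))

end Coordinates

/-! ### Exterior algebra: Berezin integral and the secondary form -/

section Algebra

variable (V : Type*) [AddCommGroup V] [Module ℝ V]

/-- `Λ V*`. -/
abbrev Forms : Type _ := ExteriorAlgebra ℝ (Dual ℝ V)

instance [Module.Finite ℝ V] : Module.Finite ℝ (Forms V) :=
  Module.Finite.of_basis (finBasis ℝ (Dual ℝ V)).ExteriorAlgebra

/-- The grading of `Λ V*` by the degree. -/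
abbrev formsGrading : ℕ → Submodule ℝ (Forms V) := fun i ↦ ⋀[ℝ]^i (Dual ℝ V)

/-- The graded tensor product `Λ V* ⊗̂ Λ V*`, where the second factor is the one marked with
a hat. -/
abbrev DoubleForms : Type _ := formsGrading V ᵍ⊗[ℝ] formsGrading V

variable {V}

/-- A covector `α`, as an element of `Λ V*`. -/
abbrev covec (α : Dual ℝ V) : Forms V := ExteriorAlgebra.ι ℝ α

/-- The evaluation `β ↦ β(e_1, …, e_m)` of forms on the vectors `e_1, …, e_m`: it vanishes on forms
of degree different from `m`, and `α_1 ∧ … ∧ α_m ↦ det (α_i (e_j))`. -/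
def evalOn {m : ℕ} (e : Fin m → V) : Forms V →ₗ[ℝ] ℝ :=
  ExteriorAlgebra.liftAlternating fun i ↦
    if h : i = m then
      (Matrix.detRowAlternating.compLinearMap
        (LinearMap.pi fun j ↦ Dual.eval ℝ V (e j))).domDomCongr (finCongr h.symm)
    else 0

/-- The Berezin integral `α ⊗̂ β ↦ (-1)^{m(m+1)/2} π^{-m/2} β(e_1, …, e_m) α` of a vector space of
dimension `m`, with respect to the orientation `o`; here `e` is any orthonormal basis, and the sign
is reversed if `e` is not positively oriented. -/
def berezin {m : ℕ} (o : Orientation ℝ V (Fin m)) (e : Basis (Fin m) ℝ V) :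
    DoubleForms V →ₗ[ℝ] Forms V :=
  (open scoped Classical in if e.orientation = o then (1 : ℝ) else -1) •
    ((-1) ^ (m * (m + 1) / 2) * Real.pi ^ (-(m : ℝ) / 2)) •
    ((TensorProduct.rid ℝ (Forms V)).toLinearMap ∘ₗ
      TensorProduct.map LinearMap.id (evalOn e) ∘ₗ
      (GradedTensorProduct.of ℝ (formsGrading V) (formsGrading V)).symm.toLinearMap)

/-- The exponential series `∑ a^k / k!`, a finite sum for nilpotent `a`. -/
def expNilpotent {A : Type*} [Ring A] [Algebra ℝ A] (a : A) : A :=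
  ∑ᶠ k : ℕ, ((k.factorial : ℝ)⁻¹) • a ^ k

/-- The integral over `[0,1]` of a function with values in a finite-dimensional vector space,
computed in coordinates. -/
def integral01 {W : Type*} [AddCommGroup W] [Module ℝ W] [Module.Finite ℝ W] (f : ℝ → W) : W :=
  ∑ i, (∫ u in (0 : ℝ)..1, (finBasis ℝ W).repr (f u) i) • finBasis ℝ W i

/-- `-∫₀¹ du/u ∫^B exp(-R/2 - u² S²) ∑_{k ≥ 1} (uS)^k / (2 Γ(k/2+1))`. -/
def secondaryForm [Module.Finite ℝ V] {m : ℕ} (o : Orientation ℝ V (Fin m)) (e : Basis (Fin m) ℝ V)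
    (R S : DoubleForms V) : Forms V :=
  -integral01 fun u : ℝ ↦ u⁻¹ • berezin o e
    (expNilpotent (-(1 / 2 : ℝ) • R - u ^ 2 • S ^ 2) *
      ∑ᶠ k : ℕ, if 1 ≤ k then (2 * Real.Gamma ((k : ℝ) / 2 + 1))⁻¹ • (u • S) ^ k else 0)

/-- `½ ∑_{k,l} ⟨e_k, R e_l⟩ ê^k ∧ ê^l` for an orthonormal basis `e`, where `⟨e_k, R e_l⟩` is
the 2-form `(u,v) ↦ ⟨e_k, R(u,v) e_l⟩`, that is, `½ ∑_{i,j} ⟨e_k, R(e_i,e_j) e_l⟩ e^i ∧ e^j`. -/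
def curvatureDoubleForm {m : ℕ} (e : Basis (Fin m) ℝ V) (q : V → V → ℝ) (R : V → V → V → V) :
    DoubleForms V :=
  (1 / 2 : ℝ) • ∑ k, ∑ l,
    ((1 / 2 : ℝ) • ∑ i, ∑ j, q (e k) (R (e i) (e j) (e l)) •
      (covec (e.coord i) * covec (e.coord j))) ᵍ⊗ₜ[ℝ] (covec (e.coord k) * covec (e.coord l))

/-- `½ ∑_k σ_k ⊗̂ ê^k` for an orthonormal basis `e`, where `σ_k` is the 1-form `v ↦ σ(v, e_k)`. -/
def shapeDoubleForm {m : ℕ} (e : Basis (Fin m) ℝ V) (σ : V → V → ℝ) : DoubleForms V :=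
  (1 / 2 : ℝ) • ∑ k, (∑ j, σ (e j) (e k) • covec (e.coord j)) ᵍ⊗ₜ[ℝ] covec (e.coord k)

end Algebra

/-! ### The boundary of a Riemannian manifold -/

section Manifold

variable {m : ℕ} {X : Type*} [TopologicalSpace X] [ChartedSpace (EuclideanHalfSpace (m + 1)) X]

/-- The hyperplane `x₀ = 0` bounding the half-space `x₀ ≥ 0`. As `TangentSpace (𝓡∂ (m + 1)) p` is
identified with `EuclideanSpace ℝ (Fin (m + 1))` by the preferred chart at `p`, this is also the
tangent space `T_p ∂X` of the boundary at a boundary point `p`. -/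
abbrev BoundaryTangent (m : ℕ) : Submodule ℝ (EuclideanSpace ℝ (Fin (m + 1))) :=
  LinearMap.ker (EuclideanSpace.proj 0 : EuclideanSpace ℝ (Fin (m + 1)) →L[ℝ] ℝ).toLinearMap

theorem chart_mem_of_mem_boundary (p : (𝓡∂ (m + 1)).boundary X) :
    extChartAt (𝓡∂ (m + 1)) (p : X) p ∈ BoundaryTangent m := by
  have h : extChartAt (𝓡∂ (m + 1)) (p : X) p ∈ frontier (range (𝓡∂ (m + 1))) := p.2
  rw [frontier_range_modelWithCornersEuclideanHalfSpace] at h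
  exact LinearMap.mem_ker.2 (show (_ : ℝ) = 0 from (Set.mem_ofPred.1 h).symm)

/-- The coordinates of a boundary point in the preferred chart at this point. -/
def boundaryCoord (p : (𝓡∂ (m + 1)).boundary X) : BoundaryTangent m :=
  ⟨extChartAt (𝓡∂ (m + 1)) (p : X) p, chart_mem_of_mem_boundary p⟩

variable [IsManifold (𝓡∂ (m + 1)) ∞ X]

/-- Smooth Riemannian metrics on the `(m+1)`-dimensional manifold with boundary `X`. -/
abbrev Metric (m : ℕ) (X : Type*) [TopologicalSpace X]
    [ChartedSpace (EuclideanHalfSpace (m + 1)) X] [IsManifold (𝓡∂ (m + 1)) ∞ X] : Type _ :=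
  ContMDiffRiemannianMetric (𝓡∂ (m + 1)) ∞ (EuclideanSpace ℝ (Fin (m + 1)))
    (fun x : X ↦ TangentSpace (𝓡∂ (m + 1)) x)

/-- The metric in the preferred chart at `p`. -/
def metricInChart (g : Metric m X) (p : X) (x : EuclideanSpace ℝ (Fin (m + 1))) :
    EuclideanSpace ℝ (Fin (m + 1)) →L[ℝ] EuclideanSpace ℝ (Fin (m + 1)) →L[ℝ] ℝ :=
  let A : EuclideanSpace ℝ (Fin (m + 1)) →L[ℝ] EuclideanSpace ℝ (Fin (m + 1)) :=
    mfderivWithin 𝓘(ℝ, EuclideanSpace ℝ (Fin (m + 1))) (𝓡∂ (m + 1))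
      (extChartAt (𝓡∂ (m + 1)) p).symm (range (𝓡∂ (m + 1))) x
  ContinuousLinearMap.bilinearComp
    (show EuclideanSpace ℝ (Fin (m + 1)) →L[ℝ] EuclideanSpace ℝ (Fin (m + 1)) →L[ℝ] ℝ from
      g.inner ((extChartAt (𝓡∂ (m + 1)) p).symm x)) A A

/-- The metric induced on the boundary, in the chart of the boundary given by the preferred chart
of `X` at `p`. -/
def boundaryMetricInChart (g : Metric m X) (p : X) (y : BoundaryTangent m) :
    BoundaryTangent m →L[ℝ] BoundaryTangent m →L[ℝ] ℝ :=
  (metricInChart g p y).bilinearComp (BoundaryTangent m).subtypeL (BoundaryTangent m).subtypeL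

/-- The inward pointing unit normal vector field along the boundary, in the preferred chart
at `p`: the gradient of the coordinate `x₀`, normalized. -/
def inwardNormal (g : Metric m X) (p : X) (y : BoundaryTangent m) :
    EuclideanSpace ℝ (Fin (m + 1)) :=
  let a := (metricInChart g p y).inverse (EuclideanSpace.proj 0)
  (√(metricInChart g p y a a))⁻¹ • a

/-- The inner product of `g` on `T_p ∂X`. -/
def boundaryInner (g : Metric m X) (p : X) (v w : BoundaryTangent m) : ℝ :=
  g.inner p (v : EuclideanSpace ℝ (Fin (m + 1))) (w : EuclideanSpace ℝ (Fin (m + 1)))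

/-- `(v, w) ↦ ⟨∇_v 𝔫, w⟩` on `T_p ∂X`, where `∇` is the Levi-Civita connection of `g` on `TX` and
`𝔫` the inward pointing unit normal. -/
def secondFundamental (g : Metric m X) (p : (𝓡∂ (m + 1)).boundary X)
    (v w : BoundaryTangent m) : ℝ :=
  let Dn : EuclideanSpace ℝ (Fin (m + 1)) :=
    covariantAlong (metricInChart g p) (range (𝓡∂ (m + 1)))
      (BoundaryTangent m).subtypeL (inwardNormal g p) (boundaryCoord p) v
  g.inner p Dn (w : EuclideanSpace ℝ (Fin (m + 1)))

/-- The curvature tensor at `p` of the metric induced by `g` on the boundary. -/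
def boundaryCurvature (g : Metric m X) (p : (𝓡∂ (m + 1)).boundary X)
    (u v w : BoundaryTangent m) : BoundaryTangent m :=
  curvature (boundaryMetricInChart g p) univ (boundaryCoord p) u v w

/-- `e` is an orthonormal basis of `(T_p ∂X, g)`. -/
def IsOrthonormal (g : Metric m X) (p : X) (e : Basis (Fin m) ℝ (BoundaryTangent m)) : Prop :=
  ∀ i j, boundaryInner g p (e i) (e j) = if i = j then 1 else 0

theorem finrank_boundaryTangent (m : ℕ) : finrank ℝ (BoundaryTangent m) = m := by
  have hf : (EuclideanSpace.proj 0 : EuclideanSpace ℝ (Fin (m + 1)) →L[ℝ] ℝ).toLinearMap ≠ 0 := by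
    intro h
    have := LinearMap.congr_fun h (EuclideanSpace.single 0 (1 : ℝ))
    simp at this
  have := Module.Dual.finrank_ker_add_one_of_ne_zero hf
  rw [finrank_euclideanSpace_fin] at this
  exact Nat.succ_injective this

theorem exists_orthonormalBasis {V : Type*} [AddCommGroup V] [Module ℝ V] [Module.Finite ℝ V]
    {m : ℕ} (hm : finrank ℝ V = m) (q : V →ₗ[ℝ] V →ₗ[ℝ] ℝ) (hs : ∀ v w, q v w = q w v)
    (hp : ∀ v, v ≠ 0 → 0 < q v v) :
    ∃ e : Basis (Fin m) ℝ V, ∀ i j, q (e i) (e j) = if i = j then 1 else 0 := by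
  let c : InnerProductSpace.Core ℝ V :=
    { inner := fun v w ↦ q v w
      conj_inner_symm := fun v w ↦ hs w v
      re_inner_nonneg := fun v ↦ by
        rcases eq_or_ne v 0 with rfl | h
        · simp
        · exact (hp v h).le
      add_left := fun u v w ↦ by simp
      smul_left := fun u v r ↦ by simp
      definite := fun v h ↦ by
        by_contra hv
        exact (hp v hv).ne' h }
  let _ : NormedAddCommGroup V := c.toNormedAddCommGroup
  let _ : InnerProductSpace ℝ V := InnerProductSpace.ofCore c.toCore
  let b := (stdOrthonormalBasis ℝ V).reindex (finCongr hm)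
  refine ⟨b.toBasis, fun i j ↦ ?_⟩
  have := b.inner_eq_ite i j
  rw [b.coe_toBasis]
  exact this

theorem exists_isOrthonormal (g : Metric m X) (p : X) :
    ∃ e : Basis (Fin m) ℝ (BoundaryTangent m), IsOrthonormal g p e := by
  let q₀ : EuclideanSpace ℝ (Fin (m + 1)) →L[ℝ] EuclideanSpace ℝ (Fin (m + 1)) →L[ℝ] ℝ := g.inner p
  let q : BoundaryTangent m →ₗ[ℝ] BoundaryTangent m →ₗ[ℝ] ℝ :=
    LinearMap.mk₂ ℝ (fun v w ↦ q₀ v w) (by simp) (by simp) (by simp) (by simp)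
  exact exists_orthonormalBasis (finrank_boundaryTangent m) q (fun v w ↦ g.symm p _ _)
    fun v hv ↦ g.pos p _ fun h ↦ hv (Subtype.ext h)

/-- An orthonormal basis of `(T_p ∂X, g)`. -/
def orthonormalFrame (g : Metric m X) (p : X) : Basis (Fin m) ℝ (BoundaryTangent m) :=
  (exists_isOrthonormal g p).choose

/-- The double form `Ṙ` of the curvature of the boundary, at `p`. -/
def curvatureForm (g : Metric m X) (p : (𝓡∂ (m + 1)).boundary X) :
    DoubleForms (BoundaryTangent m) :=
  curvatureDoubleForm (orthonormalFrame g p) (boundaryInner g p) (boundaryCurvature g p)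

/-- The double form `Ṡ` of the second fundamental form of the boundary, at `p`. -/
def shapeForm (g : Metric m X) (p : (𝓡∂ (m + 1)).boundary X) :
    DoubleForms (BoundaryTangent m) :=
  shapeDoubleForm (orthonormalFrame g p) (secondFundamental g p)

/-- The Brüning–Ma secondary class `B(∇^{TX})` of the Levi-Civita connection of `g`, at the boundary
point `p` and for the orientation `o` of `T_p ∂X`. The dependence on `o` is that of a differential
form on `∂X` with values in the orientation bundle of `∂X`; a choice of an orientation of `∂X`
turns it into a differential form on `∂X`. -/
def secondaryClass (g : Metric m X) (p : (𝓡∂ (m + 1)).boundary X)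
    (o : Orientation ℝ (BoundaryTangent m) (Fin m)) : Forms (BoundaryTangent m) :=
  secondaryForm o (orthonormalFrame g p) (curvatureForm g p) (shapeForm g p)

end Manifold

end

end BruningMa

/-!
The class `B` is scale invariant because the factors of `s` carried by `Ṙ` and `Ṡ` are those of a
rescaling of the hatted covectors, and the Berezin integral undoes this rescaling.

*Geometry.* The metrics `g₁` and `g₂ = s g₁` have the same Christoffel symbols (`christoffel_smul`),
hence the same Levi-Civita connection, and the induced metrics have the same curvature tensor
(`boundaryCurvature_eq`). The unit normal of `g₂` is `s ^ (-1/2)` times that of `g₁`, so that the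
bilinear form `⟨∇𝔫, ·⟩` is multiplied by `s · s ^ (-1/2) = √s` (`secondFundamental_eq_mul`), while
`⟨·, R ·⟩` is multiplied by `s`.

*Frames.* In `Ṙ` and `Ṡ` every frame vector `e_k` is paired with its own dual covector `e^k`. As
`∑ e_k ⊗ e^k` is the same for all bases (`sum_basis_coord_eq`), these double forms depend only on
the tensors `⟨·, R ·⟩` and `⟨∇𝔫, ·⟩`, not on the frame. For `Ṙ` this needs the curvature to be
trilinear, which is where smoothness and nondegeneracy of the metric enter (`curvatureTrilinear`).
Since `Ṙ` has degree 2 and `Ṡ` degree 1 in the hatted covectors, `Ṙ₂ = φ Ṙ₁` and `Ṡ₂ = φ Ṡ₁` for the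
algebra endomorphism `φ = hatScale √s` that multiplies the hatted covectors by `√s`.

*Berezin integral.* An injective algebra endomorphism commutes with the exponential and with the
series in `Ṡ`, and `φ` multiplies the part of top hatted degree by `s ^ (m/2)`. An orthonormal basis
of `g₂` has determinant `± s ^ (-m/2)` with respect to one of `g₁` (`pow_mul_abs_det_eq_one`), and
the sign is accounted for by the orientation; so `∫ᴮ₂ ∘ φ = ∫ᴮ₁` (`berezin_hatScale`), and the
integrands over `u` agree.
-/

namespace BruningMa

noncomputable section

/-! ### Rescaling the hatted covectors -/

section HatScaling

variable {V : Type*} [AddCommGroup V] [Module ℝ V]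

/-- The extension of `t • id` to the exterior algebra is `t ^ j` in degree `j`. -/
theorem exteriorAlgebra_map_smul_of_mem {M : Type*} [AddCommGroup M] [Module ℝ M] (t : ℝ) (j : ℕ)
    {b : ExteriorAlgebra ℝ M} (hb : b ∈ ⋀[ℝ]^j M) :
    ExteriorAlgebra.map (t • LinearMap.id) b = t ^ j • b := by
  rw [← ExteriorAlgebra.ιMulti_span_fixedDegree] at hb
  induction hb using Submodule.span_induction with
  | mem x hx =>
    obtain ⟨v, rfl⟩ := hx
    rw [ExteriorAlgebra.map_apply_ιMulti]
    have : (⇑(t • LinearMap.id : M →ₗ[ℝ] M) ∘ v) = fun i ↦ (fun _ : Fin j ↦ t) i • v i := rfl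
    rw [this, AlternatingMap.map_smul_univ]
    simp
  | zero => simp
  | add x y _ _ hx hy => rw [map_add, hx, hy, smul_add]
  | smul a x _ hx => rw [map_smul, hx, smul_comm]

/-- The algebra endomorphism of `Λ V* ⊗̂ Λ V*` that is the identity on the first factor and
multiplies the covectors of the second factor by `t`. -/
def hatScale (t : ℝ) : DoubleForms V →ₐ[ℝ] DoubleForms V :=
  GradedTensorProduct.lift (formsGrading V) (formsGrading V)
    (GradedTensorProduct.includeLeft (formsGrading V) (formsGrading V))
    ((GradedTensorProduct.includeRight (formsGrading V) (formsGrading V)).comp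
      (ExteriorAlgebra.map (t • LinearMap.id)))
    (by
      intro i j a b
      have h := GradedTensorProduct.tmul_coe_mul_coe_tmul (R := ℝ) (formsGrading V) (formsGrading V)
        1 b a 1
      rw [one_mul, mul_one] at h
      rw [AlgHom.comp_apply, exteriorAlgebra_map_smul_of_mem t j b.2, map_smul, mul_smul_comm,
        smul_mul_assoc, smul_comm _ (t ^ j)]
      congr 1
      simp only [GradedTensorProduct.includeLeft_apply, GradedTensorProduct.includeRight_apply]
      rw [h, GradedTensorProduct.tmul_one_mul_one_tmul, smul_smul, Int.units_mul_self, one_smul])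

theorem hatScale_tmul (t : ℝ) (a b : Forms V) :
    hatScale t (a ᵍ⊗ₜ[ℝ] b : DoubleForms V)
      = a ᵍ⊗ₜ[ℝ] ExteriorAlgebra.map (t • LinearMap.id) b := by
  rw [hatScale, GradedTensorProduct.lift_tmul]
  exact GradedTensorProduct.tmul_one_mul_one_tmul _ _ _ _

theorem hatScale_hatScale (t r : ℝ) (x : DoubleForms V) :
    hatScale t (hatScale r x) = hatScale (t * r) x := by
  have : (hatScale t).comp (hatScale r) = hatScale (V := V) (t * r) := by
    refine AlgHom.toLinearMap_injective (GradedTensorProduct.hom_ext _ _ ?_)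
    refine TensorProduct.ext' fun a b ↦ ?_
    change hatScale t (hatScale r (a ᵍ⊗ₜ[ℝ] b : DoubleForms V)) =
      hatScale (t * r) (a ᵍ⊗ₜ[ℝ] b : DoubleForms V)
    rw [hatScale_tmul, hatScale_tmul, hatScale_tmul, ← AlgHom.comp_apply,
      ExteriorAlgebra.map_comp_map]
    congr 3
    ext v
    simp [mul_smul]
  exact DFunLike.congr_fun this x

theorem hatScale_one (x : DoubleForms V) : hatScale 1 x = x := by
  have : hatScale (V := V) 1 = AlgHom.id ℝ _ := by
    refine AlgHom.toLinearMap_injective (GradedTensorProduct.hom_ext _ _ ?_)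
    refine TensorProduct.ext' fun a b ↦ ?_
    change hatScale 1 (a ᵍ⊗ₜ[ℝ] b : DoubleForms V) = (a ᵍ⊗ₜ[ℝ] b : DoubleForms V)
    rw [hatScale_tmul, one_smul, ExteriorAlgebra.map_id, AlgHom.id_apply]
  rw [this, AlgHom.id_apply]

theorem hatScale_injective {t : ℝ} (ht : t ≠ 0) :
    Function.Injective (hatScale (V := V) t) :=
  Function.LeftInverse.injective (g := hatScale t⁻¹) fun x ↦ by
    rw [hatScale_hatScale, inv_mul_cancel₀ ht, hatScale_one]

/-- As `φ` is injective, it commutes with `∑ᶠ` even if `a` is not nilpotent and the sum has its junk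
value `0`. -/
theorem map_expNilpotent {A B : Type*} [Ring A] [Algebra ℝ A] [Ring B] [Algebra ℝ B]
    (φ : A →ₐ[ℝ] B) (hφ : Function.Injective φ) (a : A) :
    φ (expNilpotent a) = expNilpotent (φ a) := by
  rw [expNilpotent, expNilpotent]
  refine (φ.toRingHom.toAddMonoidHom.map_finsum_of_injective hφ _).trans (finsum_congr fun k ↦ ?_)
  change φ _ = _
  rw [map_smul, map_pow]

end HatScaling

/-! ### The Berezin integral under rescaling and change of basis -/

section Berezin

variable {V : Type*} [AddCommGroup V] [Module ℝ V] {m : ℕ}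

theorem evalOn_ιMulti (e : Fin m → V) (α : Fin m → Dual ℝ V) :
    evalOn e (ExteriorAlgebra.ιMulti ℝ m α) = (Matrix.of fun i j ↦ α i (e j)).det := by
  rw [evalOn, ExteriorAlgebra.liftAlternating_apply_ιMulti, dif_pos rfl]
  rfl

theorem evalOn_ιMulti_of_ne (e : Fin m → V) {i : ℕ} (hi : i ≠ m) (α : Fin i → Dual ℝ V) :
    evalOn e (ExteriorAlgebra.ιMulti ℝ i α) = 0 := by
  rw [evalOn, ExteriorAlgebra.liftAlternating_apply_ιMulti, dif_neg hi]
  rfl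

/-- Changing the basis and scaling the covectors by `t` multiplies the top degree evaluation by
`t ^ m` times the determinant of the new basis. -/
theorem evalOn_map_smul (e f : Basis (Fin m) ℝ V) (t : ℝ) (β : Forms V) :
    evalOn f (ExteriorAlgebra.map (t • LinearMap.id) β) = (t ^ m * e.det f) * evalOn e β := by
  have : evalOn f ∘ₗ (ExteriorAlgebra.map (t • LinearMap.id)).toLinearMap
      = (t ^ m * e.det f) • evalOn e := by
    refine ExteriorAlgebra.lhom_ext fun i ↦ AlternatingMap.ext fun α ↦ ?_
    change evalOn f (ExteriorAlgebra.map (t • LinearMap.id) (ExteriorAlgebra.ιMulti ℝ i α))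
      = (t ^ m * e.det f) * evalOn e (ExteriorAlgebra.ιMulti ℝ i α)
    rw [ExteriorAlgebra.map_apply_ιMulti]
    rcases eq_or_ne i m with rfl | hi
    · rw [evalOn_ιMulti, evalOn_ιMulti]
      have : (Matrix.of fun k j ↦ (⇑(t • LinearMap.id : Dual ℝ V →ₗ[ℝ] Dual ℝ V) ∘ α) k (f j))
          = t • ((Matrix.of fun k j ↦ α k (e j)) * e.toMatrix f) := by
        ext k j
        have h := congrArg (α k) (e.sum_toMatrix_smul_self f j)
        rw [map_sum] at h
        simp only [map_smul, smul_eq_mul] at h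
        simp only [Matrix.of_apply, Matrix.smul_apply, Matrix.mul_apply, smul_eq_mul]
        change t * α k (f j) = _
        rw [← h]
        simp only [mul_comm]
      rw [this, Matrix.det_smul, Matrix.det_mul, Basis.det_apply, Fintype.card_fin]
      ring
    · rw [evalOn_ιMulti_of_ne _ hi, evalOn_ιMulti_of_ne _ hi, mul_zero]
  exact LinearMap.congr_fun this β

/-- The sign in the Berezin integral compensates the sign of the determinant of a change of
basis. -/
theorem orientation_sign_mul_det
    (o : Orientation ℝ V (Fin m)) (e f : Basis (Fin m) ℝ V) :
    (open scoped Classical in if f.orientation = o then (1 : ℝ) else -1) * e.det f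
      = (open scoped Classical in if e.orientation = o then (1 : ℝ) else -1) * |e.det f| := by
  classical
  by_cases hef : e.orientation = f.orientation
  · rw [← hef, abs_of_pos ((e.orientation_eq_iff_det_pos f).1 hef)]
  · have hdet : e.det f < 0 :=
      lt_of_le_of_ne (not_lt.1 fun h ↦ hef ((e.orientation_eq_iff_det_pos f).2 h))
        (e.isUnit_det f).ne_zero
    have hf : f.orientation = -e.orientation :=
      (e.orientation_ne_iff_eq_neg _).1 (Ne.symm hef)
    rw [abs_of_neg hdet]
    rcases e.orientation_eq_or_eq_neg o with ho | ho
    · rw [if_neg (fun h ↦ hef (ho.symm.trans h.symm)), if_pos ho.symm]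
      ring
    · rw [if_pos (hf.trans ho.symm), if_neg (fun h ↦ hef (h.trans (ho.trans hf.symm)))]
      ring

theorem berezin_tmul (o : Orientation ℝ V (Fin m)) (e : Basis (Fin m) ℝ V) (α β : Forms V) :
    berezin o e (α ᵍ⊗ₜ[ℝ] β)
      = (open scoped Classical in if e.orientation = o then (1 : ℝ) else -1) •
        ((-1) ^ (m * (m + 1) / 2) * Real.pi ^ (-(m : ℝ) / 2)) • (evalOn e β • α) := by
  rfl

/-- Scaling the hatted covectors by `t` is absorbed by passing to a basis whose volume is
`t ^ (-m)` times as large. -/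
theorem berezin_hatScale (o : Orientation ℝ V (Fin m))
    (e f : Basis (Fin m) ℝ V) {t : ℝ} (h : t ^ m * |e.det f| = 1) (x : DoubleForms V) :
    berezin o f (hatScale t x) = berezin o e x := by
  have : berezin o f ∘ₗ (hatScale t).toLinearMap = berezin o e := by
    refine GradedTensorProduct.hom_ext _ _ (TensorProduct.ext' fun a b ↦ ?_)
    change berezin o f (hatScale t (a ᵍ⊗ₜ[ℝ] b : DoubleForms V))
      = berezin o e (a ᵍ⊗ₜ[ℝ] b : DoubleForms V)
    rw [hatScale_tmul, berezin_tmul, berezin_tmul, evalOn_map_smul e f]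
    simp only [smul_smul]
    congr 1
    have hs := orientation_sign_mul_det o e f
    linear_combination (t ^ m * ((-1) ^ (m * (m + 1) / 2) * Real.pi ^ (-(m : ℝ) / 2))
      * evalOn e b) * hs + ((open scoped Classical in if e.orientation = o then (1 : ℝ) else -1)
        * ((-1) ^ (m * (m + 1) / 2) * Real.pi ^ (-(m : ℝ) / 2)) * evalOn e b) * h
  exact LinearMap.congr_fun this x

/-- The integrands of the two sides agree for every `u`. -/
theorem secondaryForm_hatScale [Module.Finite ℝ V]
    (o : Orientation ℝ V (Fin m)) (e f : Basis (Fin m) ℝ V) {t : ℝ} (ht : t ≠ 0)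
    (h : t ^ m * |e.det f| = 1) (R S : DoubleForms V) :
    secondaryForm o f (hatScale t R) (hatScale t S) = secondaryForm o e R S := by
  have hinj := hatScale_injective (V := V) ht
  rw [secondaryForm, secondaryForm]
  congr 2
  funext u
  rw [← berezin_hatScale o e f h]
  congr 2
  rw [map_mul, map_expNilpotent _ hinj, map_sub, map_smul, map_smul, map_pow]
  congr 1
  refine Eq.symm (((hatScale t).toRingHom.toAddMonoidHom.map_finsum_of_injective hinj _).trans
    (finsum_congr fun k ↦ ?_))
  change hatScale t _ = _
  split_ifs
  · rw [map_smul, map_pow, map_smul]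
  · rw [map_zero]

end Berezin

/-! ### Double forms and change of basis -/

section BasisChange

variable {V : Type*} [AddCommGroup V] [Module ℝ V] {m : ℕ}

/-- The canonical element `∑ eᵢ ⊗ eⁱ` of `V ⊗ V*` does not depend on the basis. -/
theorem sum_basis_coord_eq {W : Type*} [AddCommGroup W] [Module ℝ W] (e f : Basis (Fin m) ℝ V)
    (B : V → Dual ℝ V → W) (h₁ : ∀ α, IsLinearMap ℝ fun v ↦ B v α)
    (h₂ : ∀ v, IsLinearMap ℝ (B v)) :
    ∑ i, B (f i) (f.coord i) = ∑ i, B (e i) (e.coord i) := by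
  have hf (i) : B (f i) (f.coord i) = ∑ a, B (f.coord i (e a) • f i) (e.coord a) := by
    conv_lhs => rw [← e.sum_dual_apply_smul_coord (f.coord i)]
    rw [← IsLinearMap.mk'_apply (h₂ (f i)), map_sum]
    refine Finset.sum_congr rfl fun a _ ↦ ?_
    rw [map_smul, IsLinearMap.mk'_apply, (h₁ (e.coord a)).map_smul]
  simp only [hf]
  rw [Finset.sum_comm]
  refine Finset.sum_congr rfl fun a _ ↦ ?_
  have := map_sum ((h₁ (e.coord a)).mk' _) (fun i ↦ f.coord i (e a) • f i) Finset.univ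
  simp only [IsLinearMap.mk'_apply] at this
  rw [← this]
  congr 1
  exact f.sum_repr (e a)

theorem add_gtmul (a b c : Forms V) :
    ((a + b) ᵍ⊗ₜ[ℝ] c : DoubleForms V) = a ᵍ⊗ₜ[ℝ] c + b ᵍ⊗ₜ[ℝ] c := by
  simp only [GradedTensorProduct.tmul, TensorProduct.add_tmul, map_add]

theorem gtmul_add (a b c : Forms V) :
    (a ᵍ⊗ₜ[ℝ] (b + c) : DoubleForms V) = a ᵍ⊗ₜ[ℝ] b + a ᵍ⊗ₜ[ℝ] c := by
  simp only [GradedTensorProduct.tmul, TensorProduct.tmul_add, map_add]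

theorem smul_gtmul (r : ℝ) (a b : Forms V) :
    ((r • a) ᵍ⊗ₜ[ℝ] b : DoubleForms V) = r • (a ᵍ⊗ₜ[ℝ] b) := by
  rw [GradedTensorProduct.tmul, ← TensorProduct.smul_tmul', map_smul]

theorem gtmul_smul (r : ℝ) (a b : Forms V) :
    (a ᵍ⊗ₜ[ℝ] (r • b) : DoubleForms V) = r • (a ᵍ⊗ₜ[ℝ] b) := by
  simp only [GradedTensorProduct.tmul, TensorProduct.tmul_smul, map_smul]

theorem shapeDoubleForm_basis_eq (e f : Basis (Fin m) ℝ V) (σ : V →ₗ[ℝ] V →ₗ[ℝ] ℝ) :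
    shapeDoubleForm f (fun v w ↦ σ v w) = shapeDoubleForm e (fun v w ↦ σ v w) := by
  rw [shapeDoubleForm, shapeDoubleForm]
  congr 1
  have h (w : V) : ∑ j, σ (f j) w • covec (f.coord j) = ∑ j, σ (e j) w • covec (e.coord j) :=
    sum_basis_coord_eq e f (fun v α ↦ σ v w • covec α)
      (fun α ↦ ⟨by simp [add_smul], by simp [mul_smul]⟩)
      (fun v ↦ ⟨by simp, fun c x ↦ by simp [smul_comm c]⟩)
  simp only [h]
  refine sum_basis_coord_eq e f
    (fun v α ↦ ((∑ j, σ (e j) v • covec (e.coord j)) ᵍ⊗ₜ[ℝ] covec α : DoubleForms V))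
    (fun α ↦ ⟨fun x y ↦ ?_, fun c x ↦ ?_⟩) (fun v ↦ ⟨fun x y ↦ ?_, fun c x ↦ ?_⟩)
  · simp only [map_add, add_smul, Finset.sum_add_distrib, add_gtmul]
  · simp only [map_smul, smul_assoc, ← Finset.smul_sum, smul_gtmul]
  · simp only [map_add, gtmul_add]
  · simp only [map_smul, gtmul_smul]

/-- The definition contracts each argument of `(v, a, b, w) ↦ q v (R a b w)` with the canonical
element, so that any two bases give the same double form. -/
theorem curvatureDoubleForm_basis_eq (e f : Basis (Fin m) ℝ V) (q : V →ₗ[ℝ] V →ₗ[ℝ] ℝ)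
    (R : V →ₗ[ℝ] V →ₗ[ℝ] V →ₗ[ℝ] V) :
    curvatureDoubleForm f (fun v w ↦ q v w) (fun u v w ↦ R u v w)
      = curvatureDoubleForm e (fun v w ↦ q v w) (fun u v w ↦ R u v w) := by
  -- The 2-form `⟨v, R w⟩`, computed in the basis `b`.
  let Ω (b : Basis (Fin m) ℝ V) (v w : V) : Forms V :=
    (1 / 2 : ℝ) • ∑ i, ∑ j, q v (R (b i) (b j) w) • (covec (b.coord i) * covec (b.coord j))
  have hΩ (v w : V) : Ω f v w = Ω e v w := by
    simp only [Ω]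
    congr 1
    have h (u : V) (α : Dual ℝ V) : ∑ j, q v (R u (f j) w) • (covec α * covec (f.coord j))
        = ∑ j, q v (R u (e j) w) • (covec α * covec (e.coord j)) :=
      sum_basis_coord_eq e f (fun x β ↦ q v (R u x w) • (covec α * covec β))
        (fun β ↦ ⟨by simp [add_smul], by simp [mul_smul]⟩)
        (fun x ↦ ⟨by simp [mul_add], fun c y ↦ by simp [smul_comm c]⟩)
    simp only [h]
    refine sum_basis_coord_eq e f
      (fun u α ↦ ∑ j, q v (R u (e j) w) • (covec α * covec (e.coord j)))
      (fun α ↦ ⟨fun x y ↦ ?_, fun c x ↦ ?_⟩) (fun u ↦ ⟨fun x y ↦ ?_, fun c x ↦ ?_⟩)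
    · simp only [map_add, LinearMap.add_apply, add_smul, Finset.sum_add_distrib]
    · simp only [map_smul, LinearMap.smul_apply, smul_assoc, Finset.smul_sum]
    · simp only [map_add, add_mul, smul_add, Finset.sum_add_distrib]
    · simp only [map_smul, smul_mul_assoc, Finset.smul_sum, smul_comm c]
  have hadd₁ (v v' w : V) : Ω e (v + v') w = Ω e v w + Ω e v' w := by
    simp only [Ω, map_add, LinearMap.add_apply, add_smul, Finset.sum_add_distrib, smul_add]
  have hadd₂ (v w w' : V) : Ω e v (w + w') = Ω e v w + Ω e v w' := by
    simp only [Ω, map_add, add_smul, Finset.sum_add_distrib, smul_add]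
  have hsmul₁ (c : ℝ) (v w : V) : Ω e (c • v) w = c • Ω e v w := by
    simp only [Ω, map_smul, LinearMap.smul_apply, smul_assoc, ← Finset.smul_sum]
    rw [smul_comm]
  have hsmul₂ (c : ℝ) (v w : V) : Ω e v (c • w) = c • Ω e v w := by
    simp only [Ω, map_smul, smul_assoc, ← Finset.smul_sum]
    rw [smul_comm]
  change (1 / 2 : ℝ) • ∑ k, ∑ l,
      (Ω f (f k) (f l) ᵍ⊗ₜ[ℝ] (covec (f.coord k) * covec (f.coord l)) : DoubleForms V)
    = (1 / 2 : ℝ) • ∑ k, ∑ l,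
      (Ω e (e k) (e l) ᵍ⊗ₜ[ℝ] (covec (e.coord k) * covec (e.coord l)) : DoubleForms V)
  congr 1
  simp only [hΩ]
  have h (v : V) (α : Dual ℝ V) :
      ∑ l, (Ω e v (f l) ᵍ⊗ₜ[ℝ] (covec α * covec (f.coord l)) : DoubleForms V)
        = ∑ l, (Ω e v (e l) ᵍ⊗ₜ[ℝ] (covec α * covec (e.coord l)) : DoubleForms V) := by
    refine sum_basis_coord_eq e f
      (fun x β ↦ (Ω e v x ᵍ⊗ₜ[ℝ] (covec α * covec β) : DoubleForms V))
      (fun β ↦ ⟨fun x y ↦ ?_, fun c x ↦ ?_⟩) (fun u ↦ ⟨fun x y ↦ ?_, fun c x ↦ ?_⟩)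
    · simp only [hadd₂, add_gtmul]
    · simp only [hsmul₂, smul_gtmul]
    · simp only [map_add, mul_add, gtmul_add]
    · simp only [map_smul, mul_smul_comm, gtmul_smul]
  simp only [h]
  refine sum_basis_coord_eq e f
    (fun x β ↦ ∑ l, (Ω e x (e l) ᵍ⊗ₜ[ℝ] (covec β * covec (e.coord l)) : DoubleForms V))
    (fun β ↦ ⟨fun x y ↦ ?_, fun c x ↦ ?_⟩) (fun u ↦ ⟨fun x y ↦ ?_, fun c x ↦ ?_⟩)
  · simp only [hadd₁, add_gtmul, Finset.sum_add_distrib]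
  · simp only [hsmul₁, smul_gtmul, Finset.smul_sum]
  · simp only [map_add, add_mul, gtmul_add, Finset.sum_add_distrib]
  · simp only [map_smul, smul_mul_assoc, gtmul_smul, Finset.smul_sum]

theorem hatScale_shapeDoubleForm (t : ℝ) (e : Basis (Fin m) ℝ V) (σ : V → V → ℝ) :
    hatScale t (shapeDoubleForm e σ) = shapeDoubleForm e (fun v w ↦ t * σ v w) := by
  simp only [shapeDoubleForm, map_smul, map_sum, hatScale_tmul, ExteriorAlgebra.map_apply_ι,
    LinearMap.smul_apply, LinearMap.id_apply, gtmul_smul, mul_smul, ← Finset.smul_sum, smul_gtmul]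

theorem hatScale_curvatureDoubleForm (t : ℝ) (e : Basis (Fin m) ℝ V) (q : V → V → ℝ)
    (R : V → V → V → V) :
    hatScale t (curvatureDoubleForm e q R)
      = curvatureDoubleForm e (fun v w ↦ t ^ 2 * q v w) R := by
  simp only [curvatureDoubleForm, map_smul, map_sum, hatScale_tmul, map_mul,
    ExteriorAlgebra.map_apply_ι, LinearMap.smul_apply, LinearMap.id_apply, smul_mul_assoc,
    mul_smul_comm, gtmul_smul, mul_smul, ← Finset.smul_sum, smul_gtmul]
  congr 1
  rw [pow_two, mul_smul, smul_comm (1 / 2 : ℝ) t, smul_comm (1 / 2 : ℝ) t]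

/-- If `e` is orthonormal for `q` and `f` for `t² q`, then `t` times the matrix of `f` in the basis
`e` is orthogonal, so that `|det| = t ^ (-m)`. -/
theorem pow_mul_abs_det_eq_one (e f : Basis (Fin m) ℝ V) (q : V →ₗ[ℝ] V →ₗ[ℝ] ℝ) {t : ℝ}
    (ht : 0 < t) (he : ∀ i j, q (e i) (e j) = if i = j then 1 else 0)
    (hf : ∀ i j, t ^ 2 * q (f i) (f j) = if i = j then 1 else 0) :
    t ^ m * |e.det f| = 1 := by
  have hP : (t • e.toMatrix f).transpose * (t • e.toMatrix f) = 1 := by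
    ext i j
    rw [Matrix.one_apply, ← hf i j, ← e.sum_toMatrix_smul_self f i,
      ← e.sum_toMatrix_smul_self f j]
    simp only [map_sum, LinearMap.sum_apply, map_smul, LinearMap.smul_apply, he, smul_eq_mul,
      mul_ite, mul_one, mul_zero, Finset.sum_ite_eq', Finset.mem_univ, if_true,
      Matrix.mul_apply, Matrix.transpose_apply, Matrix.smul_apply, Finset.mul_sum]
    exact Finset.sum_congr rfl fun a _ ↦ by ring
  have h := congrArg Matrix.det hP
  rw [Matrix.det_mul, Matrix.det_transpose, Matrix.det_smul, Fintype.card_fin, Matrix.det_one,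
    ← Basis.det_apply] at h
  rw [← abs_of_pos (pow_pos ht m), ← abs_mul]
  exact (pow_eq_one_iff_of_nonneg (abs_nonneg _) two_ne_zero).1 (by rw [sq_abs, sq, h])

end BasisChange

/-! ### Christoffel symbols and curvature in coordinates -/

-- Instances on spaces of iterated continuous linear maps are not found at the default depth.
set_option maxSynthPendingDepth 3

/-- This holds for every `f`, as `inverse` vanishes on the maps that are not invertible, and `s • f`
is invertible if and only if `f` is. -/
theorem inverse_smul_of_ne_zero {E F : Type*} [NormedAddCommGroup E] [NormedSpace ℝ E]
    [NormedAddCommGroup F] [NormedSpace ℝ F] {s : ℝ} (hs : s ≠ 0) (f : E →L[ℝ] F) :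
    (s • f).inverse = s⁻¹ • f.inverse := by
  by_cases hf : f.IsInvertible
  · exact ContinuousLinearMap.inverse_eq
      (by ext x; simp [hf.self_apply_inverse, hs]) (by ext x; simp [hf.inverse_apply_self, hs])
  · rw [ContinuousLinearMap.inverse_of_not_isInvertible hf,
      ContinuousLinearMap.inverse_of_not_isInvertible, smul_zero]
    rintro ⟨u, hu⟩
    obtain rfl : f = s⁻¹ • (u : E →L[ℝ] F) := by rw [hu, inv_smul_smul₀ hs]
    exact hf (ContinuousLinearMap.IsInvertible.of_inverse (g := s • (u.symm : F →L[ℝ] E))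
      (by ext x; simp [hs]) (by ext x; simp [hs]))

section Coordinates

variable {F : Type*} [NormedAddCommGroup F] [NormedSpace ℝ F]

theorem christoffelLower_apply (G : F → F →L[ℝ] F →L[ℝ] ℝ) (D : Set F) (x u v w : F) :
    christoffelLower G D x u v w = (1 / 2) * (fderivWithin ℝ G D x u v w
      + fderivWithin ℝ G D x v u w - fderivWithin ℝ G D x w u v) :=
  rfl

theorem christoffelLower_smul (s : ℝ) (G : F → F →L[ℝ] F →L[ℝ] ℝ) {D : Set F} {x : F}
    (hx : UniqueDiffWithinAt ℝ D x) (u v : F) :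
    christoffelLower (s • G) D x u v = s • christoffelLower G D x u v := by
  have h : fderivWithin ℝ (s • G) D x = s • fderivWithin ℝ G D x :=
    fderivWithin_const_smul_field s hx
  ext w
  rw [_root_.smul_apply, christoffelLower_apply, christoffelLower_apply, h]
  simp only [_root_.smul_apply, smul_eq_mul]
  ring

/-- The Christoffel symbols do not change when the metric is scaled. -/
theorem christoffel_smul {s : ℝ} (hs : s ≠ 0) (G : F → F →L[ℝ] F →L[ℝ] ℝ) {D : Set F} {x : F}
    (hx : UniqueDiffWithinAt ℝ D x) (u v : F) :
    christoffel (s • G) D x u v = christoffel G D x u v := by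
  rw [christoffel, christoffelLower_smul s G hx, Pi.smul_apply, inverse_smul_of_ne_zero hs,
    map_smul, _root_.smul_apply, smul_smul, mul_inv_cancel₀ hs, one_smul, christoffel]

theorem curvature_smul {s : ℝ} (hs : s ≠ 0) (G : F → F →L[ℝ] F →L[ℝ] ℝ) (x u v w : F) :
    curvature (s • G) univ x u v w = curvature G univ x u v w := by
  simp only [curvature, christoffel_smul hs G uniqueDiffWithinAt_univ]

theorem christoffel_add_left (G : F → F →L[ℝ] F →L[ℝ] ℝ) (D : Set F) (x u u' v : F) :
    christoffel G D x (u + u') v = christoffel G D x u v + christoffel G D x u' v := by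
  simp only [christoffel, ← map_add]
  congr 1
  ext w
  simp only [christoffelLower_apply, ContinuousLinearMap.map_add, _root_.add_apply]
  ring

theorem christoffel_smul_left (G : F → F →L[ℝ] F →L[ℝ] ℝ) (D : Set F) (x : F) (c : ℝ) (u v : F) :
    christoffel G D x (c • u) v = c • christoffel G D x u v := by
  simp only [christoffel, ← map_smul]
  congr 1
  ext w
  simp only [christoffelLower_apply, ContinuousLinearMap.map_smul, _root_.smul_apply,
    smul_eq_mul]
  ring

theorem christoffel_add_right (G : F → F →L[ℝ] F →L[ℝ] ℝ) (D : Set F) (x u v v' : F) :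
    christoffel G D x u (v + v') = christoffel G D x u v + christoffel G D x u v' := by
  simp only [christoffel, ← map_add]
  congr 1
  ext w
  simp only [christoffelLower_apply, ContinuousLinearMap.map_add, _root_.add_apply]
  ring

theorem christoffel_smul_right (G : F → F →L[ℝ] F →L[ℝ] ℝ) (D : Set F) (x : F) (c : ℝ) (u v : F) :
    christoffel G D x u (c • v) = c • christoffel G D x u v := by
  simp only [christoffel, ← map_smul]
  congr 1
  ext w
  simp only [christoffelLower_apply, ContinuousLinearMap.map_smul, _root_.smul_apply,
    smul_eq_mul]
  ring

theorem differentiableAt_clm_flip {E E₁ E₂ W : Type*} [NormedAddCommGroup E] [NormedSpace ℝ E]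
    [NormedAddCommGroup E₁] [NormedSpace ℝ E₁] [NormedAddCommGroup E₂] [NormedSpace ℝ E₂]
    [NormedAddCommGroup W] [NormedSpace ℝ W] {H : E → E₁ →L[ℝ] E₂ →L[ℝ] W} {x : E}
    (hH : DifferentiableAt ℝ H x) : DifferentiableAt ℝ (fun y ↦ (H y).flip) x :=
  (ContinuousLinearMap.flipₗᵢ ℝ E₁ E₂ W).toContinuousLinearEquiv.differentiableAt.comp x hH

theorem differentiableAt_christoffelLower {G : F → F →L[ℝ] F →L[ℝ] ℝ} {x : F}
    (hG : ContDiffAt ℝ 2 G x) (u v : F) :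
    DifferentiableAt ℝ (fun y ↦ christoffelLower G univ y u v) x := by
  have hd : DifferentiableAt ℝ (fderiv ℝ G) x :=
    (hG.fderiv_right (m := 1) (by norm_num)).differentiableAt one_ne_zero
  have h (u v : F) : DifferentiableAt ℝ (fun y ↦ fderiv ℝ G y u v) x :=
    (hd.clm_apply (differentiableAt_const u)).clm_apply (differentiableAt_const v)
  have h' : DifferentiableAt ℝ (fun y ↦ ((fderiv ℝ G y).flip u).flip v) x :=
    (differentiableAt_clm_flip
      ((differentiableAt_clm_flip hd).clm_apply (differentiableAt_const u))).clm_apply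
        (differentiableAt_const v)
  simp only [christoffelLower, fderivWithin_univ]
  exact (((h u v).add (h v u)).sub h').const_smul (1 / 2 : ℝ)

/-- Differentiability of the Christoffel symbols makes the curvature, which differentiates them with
two of its arguments held fixed, additive in these arguments. -/
theorem differentiableAt_christoffel [CompleteSpace F] {G : F → F →L[ℝ] F →L[ℝ] ℝ} {x : F}
    (hG : ContDiffAt ℝ 2 G x) (hinv : (G x).IsInvertible) (u v : F) :
    DifferentiableAt ℝ (fun y ↦ christoffel G univ y u v) x := by
  obtain ⟨e, he⟩ := hinv
  have hi : DifferentiableAt ℝ (fun y ↦ (G y).inverse) x := by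
    have h := contDiffAt_map_inverse (𝕜 := ℝ) (n := 1) e
    rw [he] at h
    exact (h.differentiableAt one_ne_zero).comp x (hG.differentiableAt two_ne_zero)
  exact hi.clm_apply (differentiableAt_christoffelLower hG u v)

/-- The curvature tensor at a point where the metric is nondegenerate and of class `C²`, as a
trilinear map. -/
def curvatureTrilinear [CompleteSpace F] {G : F → F →L[ℝ] F →L[ℝ] ℝ} {x : F}
    (hG : ContDiffAt ℝ 2 G x) (hinv : (G x).IsInvertible) :
    F →ₗ[ℝ] F →ₗ[ℝ] F →ₗ[ℝ] F :=
  have hd := differentiableAt_christoffel hG hinv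
  have hadd (v v' w w' : F) :
      fderiv ℝ (fun y ↦ christoffel G univ y v w + christoffel G univ y v' w') x
        = fderiv ℝ (fun y ↦ christoffel G univ y v w) x
          + fderiv ℝ (fun y ↦ christoffel G univ y v' w') x :=
    fderiv_fun_add (hd v w) (hd v' w')
  have hsmul (c : ℝ) (v w : F) : fderiv ℝ (fun y ↦ c • christoffel G univ y v w) x
      = c • fderiv ℝ (fun y ↦ christoffel G univ y v w) x :=
    fderiv_fun_const_smul (hd v w) c
  { toFun := fun u ↦ LinearMap.mk₂ ℝ (fun v w ↦ curvature G univ x u v w)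
      (fun v v' w ↦ by
        simp only [curvature, fderivWithin_univ, hadd, christoffel_add_left,
          christoffel_add_right, map_add, _root_.add_apply]
        abel)
      (fun c v w ↦ by
        simp only [curvature, fderivWithin_univ, hsmul, christoffel_smul_left,
          christoffel_smul_right, map_smul, _root_.smul_apply, smul_sub, smul_add])
      (fun v w w' ↦ by
        simp only [curvature, fderivWithin_univ, hadd, christoffel_add_right,
          _root_.add_apply]
        abel)
      (fun c v w ↦ by
        simp only [curvature, fderivWithin_univ, hsmul,
          christoffel_smul_right, _root_.smul_apply, smul_sub, smul_add])
    map_add' := fun u u' ↦ by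
      ext v w
      simp only [LinearMap.mk₂_apply, LinearMap.add_apply, curvature, fderivWithin_univ, hadd,
        christoffel_add_left, christoffel_add_right, map_add, _root_.add_apply]
      abel
    map_smul' := fun c u ↦ by
      ext v w
      simp only [LinearMap.mk₂_apply, LinearMap.smul_apply, RingHom.id_apply, curvature,
        fderivWithin_univ, hsmul, christoffel_smul_left, christoffel_smul_right, map_smul,
        _root_.smul_apply, smul_sub, smul_add] }

/-- A positive definite bilinear form on a finite-dimensional space is invertible as a map to
the dual. -/
theorem isInvertible_of_pos [FiniteDimensional ℝ F] (B : F →L[ℝ] F →L[ℝ] ℝ)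
    (hB : ∀ v, v ≠ 0 → 0 < B v v) : B.IsInvertible := by
  have hinj : Function.Injective B.toLinearMap := by
    refine (injective_iff_map_eq_zero _).2 fun v hv ↦ ?_
    by_contra h
    have h0 : B v = 0 := hv
    simpa [h0] using hB v h
  have hdim : finrank ℝ F = finrank ℝ (F →L[ℝ] ℝ) := by
    rw [← (LinearMap.toContinuousLinearMap (𝕜 := ℝ) (E := F) (F' := ℝ)).finrank_eq]
    exact Subspace.dual_finrank_eq.symm
  exact ⟨(LinearEquiv.ofInjectiveOfFinrankEq B.toLinearMap hinj hdim).toContinuousLinearEquiv,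
    by ext; rfl⟩

end Coordinates

/-! ### Smoothness and positivity of the metric in a chart -/

section Smoothness

variable {m : ℕ} {X : Type*} [TopologicalSpace X] [ChartedSpace (EuclideanHalfSpace (m + 1)) X]
  [IsManifold (𝓡∂ (m + 1)) ∞ X]

theorem metricInChart_pos (g : Metric m X) (p : X) {x : EuclideanSpace ℝ (Fin (m + 1))}
    (hx : x ∈ (extChartAt (𝓡∂ (m + 1)) p).target) (v : EuclideanSpace ℝ (Fin (m + 1)))
    (hv : v ≠ 0) : 0 < metricInChart g p x v v := by
  refine g.pos _ _ fun h ↦ hv ?_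
  have := IsManifold.of_le (I := 𝓡∂ (m + 1)) (M := X) (m := 1) (n := ∞) (by simp)
  have hi := isInvertible_mfderivWithin_extChartAt_symm (I := 𝓡∂ (m + 1)) hx
  rw [← hi.inverse_apply_self v]
  exact (congrArg _ h).trans (map_zero _)

/-- Near the center of the preferred chart the metric is the one read in the trivialization of the
tangent bundle, hence smooth. -/
theorem contDiffWithinAt_metricInChart (g : Metric m X) (p : X) :
    ContDiffWithinAt ℝ ∞ (metricInChart g p) (range (𝓡∂ (m + 1)))
      (extChartAt (𝓡∂ (m + 1)) p p) := by
  have := IsManifold.of_le (I := 𝓡∂ (m + 1)) (M := X) (m := 1) (n := ∞) (by simp)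
  -- `g` in the trivialization of the bundle of bilinear forms at `p` is smooth at `p` ...
  have h := ((contMDiffAt_hom_bundle _).1 (g.contMDiff p)).2
  have hs := contMDiffWithinAt_extChartAt_symm_range (I := 𝓡∂ (m + 1)) (n := ∞) p
    (mem_extChartAt_target (I := 𝓡∂ (m + 1)) p)
  have h' := ContMDiffAt.comp_contMDiffWithinAt_of_eq h hs (extChartAt_to_inv p)
  refine (contMDiffWithinAt_iff_contDiffWithinAt.1 h').congr_of_eventuallyEq_of_mem ?_
    (mem_range_self _)
  -- ... and on the target of the chart it is `metricInChart`, as the inverse of the trivialization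
  -- of the tangent bundle at `p` is the derivative of the inverse chart.
  filter_upwards [extChartAt_target_mem_nhdsWithin (I := 𝓡∂ (m + 1)) p] with x hx
  ext v w
  have hb : (extChartAt (𝓡∂ (m + 1)) p).symm x ∈
      (chartAt (EuclideanHalfSpace (m + 1)) p).source := by
    rw [← extChartAt_source (𝓡∂ (m + 1))]
    exact (extChartAt (𝓡∂ (m + 1)) p).map_target hx
  have hb' : (extChartAt (𝓡∂ (m + 1)) p).symm x ∈
      (trivializationAt (EuclideanSpace ℝ (Fin (m + 1)))
        (TangentSpace (𝓡∂ (m + 1)) (M := X)) p).baseSet := by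
    simpa using hb
  have hA := TangentBundle.symmL_trivializationAt (I := 𝓡∂ (m + 1)) hb
  rw [(extChartAt (𝓡∂ (m + 1)) p).right_inv hx] at hA
  have hin := inCoordinates_apply_eq₂ (𝕜 := ℝ) (F₃ := ℝ) (E₃ := Bundle.Trivial X ℝ)
    (ϕ := g.inner ((extChartAt (𝓡∂ (m + 1)) p).symm x)) (v := v) (w := w) hb' hb' (by simp)
  refine Eq.trans ?_ hin.symm
  have hAv (u : EuclideanSpace ℝ (Fin (m + 1))) :
      (trivializationAt (EuclideanSpace ℝ (Fin (m + 1)))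
        (TangentSpace (𝓡∂ (m + 1)) (M := X)) p).symm ((extChartAt (𝓡∂ (m + 1)) p).symm x) u
        = mfderivWithin 𝓘(ℝ, EuclideanSpace ℝ (Fin (m + 1))) (𝓡∂ (m + 1))
          (extChartAt (𝓡∂ (m + 1)) p).symm (range (𝓡∂ (m + 1))) x u := by
    rw [← hA]
    exact (Trivialization.symmL_apply _ hb' u).symm
  rw [hAv, hAv]
  simp
  rfl

end Smoothness

/-! ### The boundary geometry of a scaled metric -/

section Boundary

variable {m : ℕ} {X : Type*} [TopologicalSpace X] [ChartedSpace (EuclideanHalfSpace (m + 1)) X]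

theorem boundaryTangent_subset_range (y : BoundaryTangent m) :
    (y : EuclideanSpace ℝ (Fin (m + 1))) ∈ range (𝓡∂ (m + 1)) := by
  rw [range_modelWithCornersEuclideanHalfSpace]
  exact (LinearMap.mem_ker.1 y.2).ge

variable [IsManifold (𝓡∂ (m + 1)) ∞ X]

theorem contDiffAt_boundaryMetricInChart (g : Metric m X) (p : (𝓡∂ (m + 1)).boundary X) :
    ContDiffAt ℝ 2 (boundaryMetricInChart g p) (boundaryCoord p) := by
  let Λ : (EuclideanSpace ℝ (Fin (m + 1)) →L[ℝ] EuclideanSpace ℝ (Fin (m + 1)) →L[ℝ] ℝ) →ₗ[ℝ]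
      (BoundaryTangent m →L[ℝ] BoundaryTangent m →L[ℝ] ℝ) :=
    { toFun := fun B ↦ B.bilinearComp (BoundaryTangent m).subtypeL (BoundaryTangent m).subtypeL
      map_add' := fun _ _ ↦ rfl
      map_smul' := fun _ _ ↦ rfl }
  have h : ContDiffWithinAt ℝ 2 (metricInChart g p) (range (𝓡∂ (m + 1)))
      ((BoundaryTangent m).subtypeL (boundaryCoord p)) :=
    (contDiffWithinAt_metricInChart g (p : X)).of_le (WithTop.coe_le_coe.2 (le_top : (2 : ℕ∞) ≤ ⊤))
  have h' : ContDiffAt ℝ 2 (fun y : BoundaryTangent m ↦ metricInChart g p y) (boundaryCoord p) :=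
    contDiffWithinAt_univ.1 (h.comp (t := range (𝓡∂ (m + 1))) (boundaryCoord p)
      (BoundaryTangent m).subtypeL.contDiff.contDiffWithinAt
      fun y _ ↦ boundaryTangent_subset_range y)
  exact Λ.toContinuousLinearMap.contDiff.contDiffAt.comp (boundaryCoord p) h'

theorem isInvertible_boundaryMetricInChart (g : Metric m X) (p : (𝓡∂ (m + 1)).boundary X) :
    (boundaryMetricInChart g p (boundaryCoord p)).IsInvertible :=
  isInvertible_of_pos _ fun v hv ↦ metricInChart_pos g p
    (mem_extChartAt_target (I := 𝓡∂ (m + 1)) (p : X)) v fun h ↦ hv (Subtype.ext h)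

/-- The inner product of `g` on `T_p ∂X`, as a bilinear map. -/
def boundaryInnerBilin (g : Metric m X) (p : X) :
    BoundaryTangent m →ₗ[ℝ] BoundaryTangent m →ₗ[ℝ] ℝ :=
  let q : EuclideanSpace ℝ (Fin (m + 1)) →L[ℝ] EuclideanSpace ℝ (Fin (m + 1)) →L[ℝ] ℝ := g.inner p
  LinearMap.mk₂ ℝ (fun v w ↦ q v w) (by simp) (by simp) (by simp) (by simp)

/-- The second fundamental form of the boundary, as a bilinear map. -/
def secondFundamentalBilin (g : Metric m X) (p : (𝓡∂ (m + 1)).boundary X) :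
    BoundaryTangent m →ₗ[ℝ] BoundaryTangent m →ₗ[ℝ] ℝ :=
  let q : EuclideanSpace ℝ (Fin (m + 1)) →L[ℝ] EuclideanSpace ℝ (Fin (m + 1)) →L[ℝ] ℝ := g.inner p
  LinearMap.mk₂ ℝ (fun v w ↦ q (covariantAlong (metricInChart g p) (range (𝓡∂ (m + 1)))
      (BoundaryTangent m).subtypeL (inwardNormal g p) (boundaryCoord p) v) w)
    (fun v v' w ↦ by
      simp only [covariantAlong, map_add, christoffel_add_left, _root_.add_apply]
      ring)
    (fun c v w ↦ by
      simp only [covariantAlong, map_smul, christoffel_smul_left, map_add, _root_.add_apply,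
        _root_.smul_apply, smul_eq_mul]
      ring)
    (by simp) (by simp)

section Scaling

variable {s : ℝ} {g₁ g₂ : Metric m X}

theorem metricInChart_eq_smul (hg : ∀ (p : X) (v w : TangentSpace (𝓡∂ (m + 1)) p),
      g₂.inner p v w = s * g₁.inner p v w) (p : X) :
    metricInChart g₂ p = s • metricInChart g₁ p := by
  funext x
  ext v w
  exact hg _ _ _

theorem boundaryMetricInChart_eq_smul (hg : ∀ (p : X) (v w : TangentSpace (𝓡∂ (m + 1)) p),
      g₂.inner p v w = s * g₁.inner p v w) (p : X) :
    boundaryMetricInChart g₂ p = s • boundaryMetricInChart g₁ p := by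
  funext x
  ext v w
  exact hg _ _ _

theorem boundaryCurvature_eq (hs : 0 < s)
    (hg : ∀ (p : X) (v w : TangentSpace (𝓡∂ (m + 1)) p), g₂.inner p v w = s * g₁.inner p v w)
    (p : (𝓡∂ (m + 1)).boundary X) : boundaryCurvature g₂ p = boundaryCurvature g₁ p := by
  funext u v w
  rw [boundaryCurvature, boundaryMetricInChart_eq_smul hg, curvature_smul hs.ne', boundaryCurvature]

theorem inwardNormal_eq_smul (hs : 0 < s)
    (hg : ∀ (p : X) (v w : TangentSpace (𝓡∂ (m + 1)) p), g₂.inner p v w = s * g₁.inner p v w)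
    (p : X) : inwardNormal g₂ p = (√s)⁻¹ • inwardNormal g₁ p := by
  funext y
  have hs' : √s ≠ 0 := (Real.sqrt_pos.2 hs).ne'
  simp only [inwardNormal, metricInChart_eq_smul hg, Pi.smul_apply,
    inverse_smul_of_ne_zero hs.ne', _root_.smul_apply, map_smul, smul_eq_mul]
  rw [inv_mul_cancel_left₀ hs.ne', Real.sqrt_mul (inv_nonneg.2 hs.le), Real.sqrt_inv, smul_smul,
    smul_smul]
  congr 1
  rw [mul_inv, inv_inv]
  nth_rewrite 2 [← Real.mul_self_sqrt hs.le]
  field_simp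

/-- Scaling the metric by `s` leaves the connection unchanged and multiplies the unit normal by
`s ^ (-1/2)` and the inner product by `s`. -/
theorem secondFundamental_eq_mul (hs : 0 < s)
    (hg : ∀ (p : X) (v w : TangentSpace (𝓡∂ (m + 1)) p), g₂.inner p v w = s * g₁.inner p v w)
    (p : (𝓡∂ (m + 1)).boundary X) (v w : BoundaryTangent m) :
    secondFundamental g₂ p v w = √s * secondFundamental g₁ p v w := by
  have hD : UniqueDiffWithinAt ℝ (range (𝓡∂ (m + 1)))
      ((BoundaryTangent m).subtypeL (boundaryCoord p)) :=
    (𝓡∂ (m + 1)).uniqueDiffOn _ (boundaryTangent_subset_range _)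
  have hcov : covariantAlong (metricInChart g₂ p) (range (𝓡∂ (m + 1)))
        (BoundaryTangent m).subtypeL (inwardNormal g₂ p) (boundaryCoord p) v
      = (√s)⁻¹ • covariantAlong (metricInChart g₁ p) (range (𝓡∂ (m + 1)))
        (BoundaryTangent m).subtypeL (inwardNormal g₁ p) (boundaryCoord p) v := by
    rw [covariantAlong, covariantAlong, metricInChart_eq_smul hg, christoffel_smul hs.ne' _ hD,
      inwardNormal_eq_smul hs hg, fderiv_const_smul_field, Pi.smul_apply, Pi.smul_apply,
      _root_.smul_apply, christoffel_smul_right, smul_add]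
  have hs' : √s ≠ 0 := (Real.sqrt_pos.2 hs).ne'
  let q : EuclideanSpace ℝ (Fin (m + 1)) →L[ℝ] EuclideanSpace ℝ (Fin (m + 1)) →L[ℝ] ℝ := g₁.inner p
  have h : secondFundamental g₂ p v w
      = s * q ((√s)⁻¹ • covariantAlong (metricInChart g₁ p) (range (𝓡∂ (m + 1)))
        (BoundaryTangent m).subtypeL (inwardNormal g₁ p) (boundaryCoord p) v) w := by
    rw [← hcov]
    exact hg _ _ _
  rw [h, map_smul, _root_.smul_apply, smul_eq_mul, ← mul_assoc]
  nth_rewrite 1 [← Real.mul_self_sqrt hs.le]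
  rw [mul_inv_cancel_right₀ hs']
  rfl

theorem curvatureForm_eq_hatScale (hs : 0 < s)
    (hg : ∀ (p : X) (v w : TangentSpace (𝓡∂ (m + 1)) p), g₂.inner p v w = s * g₁.inner p v w)
    (p : (𝓡∂ (m + 1)).boundary X) :
    curvatureForm g₂ p = hatScale (√s) (curvatureForm g₁ p) := by
  have hq : boundaryInner g₂ (p : X) = fun v w ↦ (s • boundaryInnerBilin g₁ (p : X)) v w := by
    funext v w
    exact hg _ _ _
  rw [curvatureForm, curvatureForm, hatScale_curvatureDoubleForm, boundaryCurvature_eq hs hg, hq,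
    Real.sq_sqrt hs.le]
  exact curvatureDoubleForm_basis_eq _ _ (s • boundaryInnerBilin g₁ (p : X))
    (curvatureTrilinear (contDiffAt_boundaryMetricInChart g₁ p)
      (isInvertible_boundaryMetricInChart g₁ p))

theorem shapeForm_eq_hatScale (hs : 0 < s)
    (hg : ∀ (p : X) (v w : TangentSpace (𝓡∂ (m + 1)) p), g₂.inner p v w = s * g₁.inner p v w)
    (p : (𝓡∂ (m + 1)).boundary X) :
    shapeForm g₂ p = hatScale (√s) (shapeForm g₁ p) := by
  have hσ : secondFundamental g₂ p = fun v w ↦ (√s • secondFundamentalBilin g₁ p) v w := by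
    funext v w
    exact secondFundamental_eq_mul hs hg p v w
  rw [shapeForm, shapeForm, hatScale_shapeDoubleForm, hσ]
  exact shapeDoubleForm_basis_eq _ _ (√s • secondFundamentalBilin g₁ p)

end Scaling

end Boundary

end

end BruningMa

theorem mainTheorem8 {m : ℕ} {X : Type*} [TopologicalSpace X] [T2Space X] [CompactSpace X]
    [ChartedSpace (EuclideanHalfSpace (m + 1)) X] [IsManifold (𝓡∂ (m + 1)) ∞ X]
    (s : ℝ) (hs : 0 < s) (g₁ g₂ : BruningMa.Metric m X)
    (hg : ∀ (p : X) (v w : TangentSpace (𝓡∂ (m + 1)) p),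
      g₂.inner p v w = s * g₁.inner p v w) :
    BruningMa.secondaryClass g₁ = BruningMa.secondaryClass g₂ := by
  funext p o
  have h₁ := (BruningMa.exists_isOrthonormal g₁ (p : X)).choose_spec
  have h₂ := (BruningMa.exists_isOrthonormal g₂ (p : X)).choose_spec
  rw [BruningMa.secondaryClass, BruningMa.secondaryClass,
    BruningMa.curvatureForm_eq_hatScale hs hg, BruningMa.shapeForm_eq_hatScale hs hg]
  refine (BruningMa.secondaryForm_hatScale o _ _ (Real.sqrt_pos.2 hs).ne' ?_ _ _).symm
  refine BruningMa.pow_mul_abs_det_eq_one _ _ (BruningMa.boundaryInnerBilin g₁ (p : X))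
    (Real.sqrt_pos.2 hs) h₁ fun i j ↦ ?_
  rw [Real.sq_sqrt hs.le, ← h₂ i j]
  exact (hg _ _ _).symm
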